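/- Let $\mathfrak{A}$ be a unital $C^*$-algebra with unit $1$, and let $\delta$ be a (possibly unbounded) complex-linear operator in $\mathfrak{A}$, defined on a dense linear subspace $\mathcal{D}(\delta)\subseteq\mathfrak{A}$. Suppose that $\delta$ is completely dissipative, that is, for every $n\ge 1$ the induced operator $\delta_n\colon (x_{ij})\mapsto(\delta(x_{ij}))$ in the $C^*$-algebra $M_n(\mathfrak{A})$, with domain $\mathcal{D}(\delta_n)=\{(x_{ij})\in M_n(\mathfrak{A}) : x_{ij}\in\mathcal{D}(\delta)\text{ for all } i,j\}$, is dissipative: $\|X-\alpha\,\delta_n(X)\|\ge\|X\|$ for all $X\in\mathcal{D}(\delta_n)$ and all real $\alpha>0$. Assume moreover that $1\in\mathcal{D}(\delta)$ and $\delta(1)=0$. Then the following hold. (a) If $x\in\mathcal{D}(\delta)$ and $x^*x\in\mathcal{D}(\delta)$, then $\delta(x^*x)\ge\delta(x)^*x+x^*\delta(x)$ in the order of $\mathfrak{A}$. (b) If $x\in\mathcal{D}(\delta)$ and $x^*\in\mathcal{D}(\delta)$, then $\delta(x^*)=\delta(x)^*$. -/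

import Mathlib

/-- A (possibly unbounded, partially defined) linear operator `T` in a complex normed space is
dissipative if `‖x‖ ≤ ‖x - α T x‖` for all `x` in its domain and all real `α > 0`. -/
def LinearPMap.IsDissipative {E : Type*} [NormedAddCommGroup E] [NormedSpace ℂ E]
    (T : E →ₗ.[ℂ] E) : Prop :=
  ∀ (x : T.domain) (α : ℝ), 0 < α → ‖(x : E)‖ ≤ ‖(x : E) - (α : ℂ) • T x‖

/-- The operator `(xᵢⱼ) ↦ (δ xᵢⱼ)` induced by `δ` on the `n × n` matrices over `A`; its domain
consists of the matrices all of whose entries lie in the domain of `δ`. -/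
def LinearPMap.matrixMap {A : Type*} [AddCommGroup A] [Module ℂ A] (δ : A →ₗ.[ℂ] A) (n : ℕ) :
    CStarMatrix (Fin n) (Fin n) A →ₗ.[ℂ] CStarMatrix (Fin n) (Fin n) A where
  domain :=
    { carrier := {M | ∀ i j, M i j ∈ δ.domain}
      add_mem' := fun {_ _} hM hN i j => δ.domain.add_mem (hM i j) (hN i j)
      zero_mem' := fun _ _ => δ.domain.zero_mem
      smul_mem' := fun c _ hM i j => δ.domain.smul_mem c (hM i j) }
  toFun :=
    { toFun := fun M => CStarMatrix.ofMatrix fun i j => δ ⟨M.1 i j, M.2 i j⟩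
      map_add' := fun M N => by
        ext i j
        exact δ.map_add ⟨M.1 i j, M.2 i j⟩ ⟨N.1 i j, N.2 i j⟩
      map_smul' := fun c M => by
        ext i j
        exact δ.map_smul c ⟨M.1 i j, M.2 i j⟩ }

/-- `δ` is completely dissipative if, for every `n ≥ 1`, the induced operator on the
C⋆-algebra of `n × n` matrices over `A` is dissipative. -/
def LinearPMap.IsCompletelyDissipative {A : Type*} [CStarAlgebra A] [PartialOrder A]
    [StarOrderedRing A] (δ : A →ₗ.[ℂ] A) : Prop :=
  ∀ n : ℕ, 1 ≤ n → (δ.matrixMap n).IsDissipative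

/-! Put `Q(u, v) = u*u + v + v*`. The column `(1 + ε²v, εu)` in the `2 × 2` matrices has squared
norm `‖1 + ε²Q(u, v) + ε⁴v*v‖`. Since `δ(1) = 0`, dissipativity on such columns gives, as `ε → 0`,
an order statement: `Q(u - αδu, v - αδv) ≤ c` implies `Q(u, v) ≤ c` (`form_le`). Perturbing a zero
`(x, v)` of `Q` in a direction close to `(δx, δv)` and letting `α → 0` yields `x*δx + (δx)*x + δv +
(δv)* ≤ 0` (`linearized_form_nonpos`). Taking `x = 0` and `±v` gives (b); `v = -x*x/2` gives (a). -/

open Filter Topology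

namespace CStarMatrix

variable {A : Type*} [CStarAlgebra A]

/-- The embedding of `A` as the upper left corner of the `2 × 2` matrices over `A`. -/
def cornerHom (A : Type*) [CStarAlgebra A] : A →⋆ₙₐ[ℂ] CStarMatrix (Fin 2) (Fin 2) A where
  toFun a := ofMatrix !![a, 0; 0, 0]
  map_smul' c a := by ext i j; fin_cases i <;> fin_cases j <;> simp
  map_zero' := by ext i j; fin_cases i <;> fin_cases j <;> simp
  map_add' _ _ := by ext i j; fin_cases i <;> fin_cases j <;> simp
  map_mul' a b := by
    ext i j; fin_cases i <;> fin_cases j <;> simp [mul_apply, Fin.sum_univ_two]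
  map_star' a := by ext i j; fin_cases i <;> fin_cases j <;> simp [star_apply]

theorem cornerHom_injective : Function.Injective (cornerHom A) := fun _ _ h =>
  congrArg (fun M : CStarMatrix (Fin 2) (Fin 2) A => M 0 0) h

variable [PartialOrder A] [StarOrderedRing A]

theorem norm_column_mul_self (a b : A) :
    ‖(ofMatrix !![a, 0; b, 0] : CStarMatrix (Fin 2) (Fin 2) A)‖ *
      ‖(ofMatrix !![a, 0; b, 0] : CStarMatrix (Fin 2) (Fin 2) A)‖ =
      ‖star a * a + star b * b‖ := by
  rw [← CStarRing.norm_star_mul_self,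
    ← NonUnitalStarAlgHom.norm_map (cornerHom A) cornerHom_injective]
  congr 1
  ext i j
  fin_cases i <;> fin_cases j <;>
    simp [cornerHom, mul_apply, star_apply, Fin.sum_univ_two]

end CStarMatrix

namespace LinearPMap

variable {A : Type*} [CStarAlgebra A]

theorem star_mul_self_column (u v : A) (ε : ℝ) :
    star (1 + ((ε ^ 2 : ℝ) : ℂ) • v) * (1 + ((ε ^ 2 : ℝ) : ℂ) • v) +
        star ((ε : ℂ) • u) * ((ε : ℂ) • u) =
      1 + ε ^ 2 • (star u * u + (v + star v)) + ε ^ 4 • (star v * v) := by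
  simp only [Complex.coe_smul, star_add, star_one, star_smul, star_trivial, smul_mul_smul_comm,
    add_mul, mul_add, one_mul, mul_one, smul_add]
  rw [show ε ^ 2 * ε ^ 2 = ε ^ 4 by ring, show ε * ε = ε ^ 2 by ring]
  abel

/-- Expansion of `u ↦ star u * u + (v + star v)` to second order at a zero of it. -/
theorem form_add_smul {x v : A} (h : star x * x + (v + star v) = 0) (r s : A) (α : ℝ) :
    star (x + (α : ℂ) • r) * (x + (α : ℂ) • r) +
        ((v + (α : ℂ) • s) + star (v + (α : ℂ) • s)) =
      α • (star x * r + star r * x + (s + star s) + α • (star r * r)) := by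
  have : star (x + (α : ℂ) • r) * (x + (α : ℂ) • r) +
        ((v + (α : ℂ) • s) + star (v + (α : ℂ) • s)) = (star x * x + (v + star v)) +
      α • (star x * r + star r * x + (s + star s) + α • (star r * r)) := by
    simp only [Complex.coe_smul, star_add, star_smul, star_trivial,
      add_mul, mul_add, smul_add, mul_smul_comm, smul_mul_assoc]
    abel
  rw [this, h, zero_add]

variable [PartialOrder A] [StarOrderedRing A] {δ : A →ₗ.[ℂ] A}

theorem IsCompletelyDissipative.norm_column_le (hδ : δ.IsCompletelyDissipative)
    (a b : δ.domain) {α : ℝ} (hα : 0 < α) :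
    ‖star (a : A) * a + star (b : A) * b‖ ≤
      ‖star ((a : A) - (α : ℂ) • δ a) * ((a : A) - (α : ℂ) • δ a) +
        star ((b : A) - (α : ℂ) • δ b) * ((b : A) - (α : ℂ) • δ b)‖ := by
  have hX : (CStarMatrix.ofMatrix !![(a : A), 0; (b : A), 0] : CStarMatrix (Fin 2) (Fin 2) A) ∈
      (δ.matrixMap 2).domain := by
    intro i j
    fin_cases i <;> fin_cases j
    exacts [a.2, δ.domain.zero_mem, b.2, δ.domain.zero_mem]
  have h := hδ 2 one_le_two ⟨_, hX⟩ α hα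
  have hsub : (CStarMatrix.ofMatrix !![(a : A), 0; (b : A), 0] : CStarMatrix (Fin 2) (Fin 2) A) -
      (α : ℂ) • (δ.matrixMap 2) ⟨_, hX⟩ =
      CStarMatrix.ofMatrix !![(a : A) - (α : ℂ) • δ a, 0; (b : A) - (α : ℂ) • δ b, 0] := by
    ext i j
    have h0 : δ ⟨0, δ.domain.zero_mem⟩ = 0 := δ.map_zero
    fin_cases i <;> fin_cases j
    · rfl
    · change (0 : A) - (α : ℂ) • δ ⟨0, δ.domain.zero_mem⟩ = 0
      simp [h0]
    · rfl
    · change (0 : A) - (α : ℂ) • δ ⟨0, δ.domain.zero_mem⟩ = 0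
      simp [h0]
  rw [hsub] at h
  rw [← CStarMatrix.norm_column_mul_self, ← CStarMatrix.norm_column_mul_self]
  exact mul_self_le_mul_self (norm_nonneg _) h

/-- Near `1` a norm bound on a positive element is an order bound, so a norm inequality at order
`ε²` becomes an inequality for the form. -/
theorem IsCompletelyDissipative.form_le (hδ : δ.IsCompletelyDissipative)
    (h1 : (1 : A) ∈ δ.domain) (hδ1 : δ ⟨1, h1⟩ = 0) (u v : δ.domain) {α c : ℝ} (hα : 0 < α)
    (hc : 0 ≤ c)
    (h : star ((u : A) - (α : ℂ) • δ u) * ((u : A) - (α : ℂ) • δ u) +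
        (((v : A) - (α : ℂ) • δ v) + star ((v : A) - (α : ℂ) • δ v)) ≤ c • (1 : A)) :
    star (u : A) * u + ((v : A) + star (v : A)) ≤ c • (1 : A) := by
  set u' := (u : A) - (α : ℂ) • δ u with hu'
  set v' := (v : A) - (α : ℂ) • δ v with hv'
  have key : ∀ ε : ℝ, 0 < ε →
      star (u : A) * u + ((v : A) + star (v : A)) ≤ (c + ε ^ 2 * ‖star v' * v'‖) • (1 : A) := by
    intro ε hε
    -- With weights `ε²` and `ε`, both `v + v*` and `u*u` enter at order `ε²`, leaving only an `ε⁴`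
    -- remainder.
    have hn := hδ.norm_column_le (⟨1, h1⟩ + ((ε ^ 2 : ℝ) : ℂ) • v) ((ε : ℂ) • u) hα
    have e1 : ((⟨1, h1⟩ + ((ε ^ 2 : ℝ) : ℂ) • v : δ.domain) : A) -
        (α : ℂ) • δ (⟨1, h1⟩ + ((ε ^ 2 : ℝ) : ℂ) • v) = 1 + ((ε ^ 2 : ℝ) : ℂ) • v' := by
      rw [δ.map_add, δ.map_smul, hδ1, zero_add, smul_comm, hv', smul_sub, ← add_sub_assoc]
      rfl
    have e2 : (((ε : ℂ) • u : δ.domain) : A) - (α : ℂ) • δ ((ε : ℂ) • u) = (ε : ℂ) • u' := by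
      rw [δ.map_smul, smul_comm, hu', smul_sub]
      rfl
    rw [e1, e2, star_mul_self_column] at hn
    change ‖star (1 + ((ε ^ 2 : ℝ) : ℂ) • (v : A)) * (1 + ((ε ^ 2 : ℝ) : ℂ) • (v : A)) +
        star ((ε : ℂ) • (u : A)) * ((ε : ℂ) • (u : A))‖ ≤ _ at hn
    have pos : ∀ p q : A, 0 ≤ 1 + ε ^ 2 • (star p * p + (q + star q)) + ε ^ 4 • (star q * q) := by
      intro p q
      rw [← star_mul_self_column]
      exact add_nonneg (star_mul_self_nonneg _) (star_mul_self_nonneg _)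
    rw [star_mul_self_column] at hn
    have hr : (0 : ℝ) ≤ 1 + ε ^ 2 * c + ε ^ 4 * ‖star v' * v'‖ := by positivity
    have hup : ‖1 + ε ^ 2 • (star u' * u' + (v' + star v')) + ε ^ 4 • (star v' * v')‖ ≤
        1 + ε ^ 2 * c + ε ^ 4 * ‖star v' * v'‖ := by
      rw [CStarAlgebra.norm_le_iff_le_algebraMap _ hr (pos _ _), Algebra.algebraMap_eq_smul_one,
        add_smul, add_smul, one_smul, mul_smul, mul_smul]
      have hv := (IsSelfAdjoint.star_mul_self v').le_algebraMap_norm_self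
      rw [Algebra.algebraMap_eq_smul_one] at hv
      gcongr
    have hlow := (CStarAlgebra.norm_le_iff_le_algebraMap _ hr (pos _ _)).1 (hn.trans hup)
    have hlow' : 1 + ε ^ 2 • (star (u : A) * u + ((v : A) + star (v : A))) ≤
        algebraMap ℝ A (1 + ε ^ 2 * c + ε ^ 4 * ‖star v' * v'‖) :=
      (le_add_of_nonneg_right (smul_nonneg (by positivity) (star_mul_self_nonneg _))).trans hlow
    rw [Algebra.algebraMap_eq_smul_one, add_assoc, add_smul, one_smul,
      show ε ^ 2 * c + ε ^ 4 * ‖star v' * v'‖ = ε ^ 2 * (c + ε ^ 2 * ‖star v' * v'‖) by ring,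
      mul_smul] at hlow'
    have := smul_le_smul_of_nonneg_left (le_of_add_le_add_left hlow')
      (show (0 : ℝ) ≤ (ε ^ 2)⁻¹ by positivity)
    rwa [inv_smul_smul₀ (by positivity), inv_smul_smul₀ (by positivity)] at this
  have hcont : Continuous fun ε : ℝ => (c + ε ^ 2 * ‖star v' * v'‖) • (1 : A) := by fun_prop
  have hlim := (hcont.tendsto 0).mono_left (nhdsWithin_le_nhds (s := Set.Ioi 0))
  have := ge_of_tendsto hlim (eventually_mem_nhdsWithin.mono key)
  simpa using this

theorem star_mul_add_star_mul_le (x r : A) :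
    star x * r + star r * x ≤ (2 * ‖x‖ * ‖r‖) • (1 : A) := by
  have hsa : IsSelfAdjoint (star x * r + star r * x) := by
    simp [IsSelfAdjoint, add_comm]
  have h := hsa.le_algebraMap_norm_self
  rw [Algebra.algebraMap_eq_smul_one] at h
  refine h.trans (smul_le_smul_of_nonneg_right ?_ zero_le_one)
  calc ‖star x * r + star r * x‖ ≤ ‖star x * r‖ + ‖star r * x‖ := norm_add_le _ _
    _ ≤ ‖star x‖ * ‖r‖ + ‖star r‖ * ‖x‖ := add_le_add (norm_mul_le _ _) (norm_mul_le _ _)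
    _ = 2 * ‖x‖ * ‖r‖ := by rw [norm_star, norm_star]; ring

theorem add_star_self_le (s : A) : s + star s ≤ (2 * ‖s‖) • (1 : A) := by
  have h := (IsSelfAdjoint.add_star_self s).le_algebraMap_norm_self
  rw [Algebra.algebraMap_eq_smul_one] at h
  refine h.trans (smul_le_smul_of_nonneg_right ?_ zero_le_one)
  calc ‖s + star s‖ ≤ ‖s‖ + ‖star s‖ := norm_add_le _ _
    _ = 2 * ‖s‖ := by rw [norm_star]; ring

/-- Here `y`, `z` stand in for `δx`, `δv`, which need not lie in the domain. The form vanishes at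
`(x, v)`, so both sides of `form_le` at `(x + αy, v + αz)` carry a factor `α`, which is cancelled
before `α → 0`. -/
theorem IsCompletelyDissipative.linearized_form_le (hδ : δ.IsCompletelyDissipative)
    (h1 : (1 : A) ∈ δ.domain) (hδ1 : δ ⟨1, h1⟩ = 0) (x v : δ.domain)
    (h : star (x : A) * x + ((v : A) + star (v : A)) = 0) (y z : δ.domain) :
    star (x : A) * y + star (y : A) * x + ((z : A) + star (z : A)) ≤
      (2 * ‖(x : A)‖ * ‖(y : A) - δ x‖ + 2 * ‖(z : A) - δ v‖) • (1 : A) := by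
  have key : ∀ α : ℝ, 0 < α →
      star (x : A) * y + star (y : A) * x + ((z : A) + star (z : A)) ≤
        (2 * ‖(x : A)‖ * ‖(y : A) - δ x - (α : ℂ) • δ y‖ +
          2 * ‖(z : A) - δ v - (α : ℂ) • δ z‖ +
          α * ‖star ((y : A) - δ x - (α : ℂ) • δ y) * ((y : A) - δ x - (α : ℂ) • δ y)‖) •
            (1 : A) := by
    intro α hα
    set r := (y : A) - δ x - (α : ℂ) • δ y with hr
    set s := (z : A) - δ v - (α : ℂ) • δ z with hs
    have eu : ((x + (α : ℂ) • y : δ.domain) : A) - (α : ℂ) • δ (x + (α : ℂ) • y) =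
        x + (α : ℂ) • r := by
      rw [δ.map_add, δ.map_smul, hr, Submodule.coe_add, Submodule.coe_smul]
      module
    have ev : ((v + (α : ℂ) • z : δ.domain) : A) - (α : ℂ) • δ (v + (α : ℂ) • z) =
        v + (α : ℂ) • s := by
      rw [δ.map_add, δ.map_smul, hs, Submodule.coe_add, Submodule.coe_smul]
      module
    have hb := hδ.form_le h1 hδ1 (x + (α : ℂ) • y) (v + (α : ℂ) • z) hα
      (c := α * (2 * ‖(x : A)‖ * ‖r‖ + 2 * ‖s‖ + α * ‖star r * r‖)) (by positivity) (by
        rw [eu, ev, form_add_smul h, mul_smul, add_smul, add_smul, mul_smul α]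
        have hrr := (IsSelfAdjoint.star_mul_self r).le_algebraMap_norm_self
        rw [Algebra.algebraMap_eq_smul_one] at hrr
        have := star_mul_add_star_mul_le (x : A) r
        have := add_star_self_le s
        gcongr)
    rw [Submodule.coe_add, Submodule.coe_smul, Submodule.coe_add, Submodule.coe_smul,
      form_add_smul h, mul_smul] at hb
    have := smul_le_smul_of_nonneg_left hb (show (0 : ℝ) ≤ α⁻¹ by positivity)
    rw [inv_smul_smul₀ hα.ne', inv_smul_smul₀ hα.ne'] at this
    exact (le_add_of_nonneg_right (smul_nonneg hα.le (star_mul_self_nonneg _))).trans this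
  have hcont : Continuous fun α : ℝ =>
      (2 * ‖(x : A)‖ * ‖(y : A) - δ x - (α : ℂ) • δ y‖ +
          2 * ‖(z : A) - δ v - (α : ℂ) • δ z‖ +
          α * ‖star ((y : A) - δ x - (α : ℂ) • δ y) * ((y : A) - δ x - (α : ℂ) • δ y)‖) •
            (1 : A) := by fun_prop
  have hlim := (hcont.tendsto 0).mono_left (nhdsWithin_le_nhds (s := Set.Ioi 0))
  have := ge_of_tendsto hlim (eventually_mem_nhdsWithin.mono key)
  simpa using this

/-- By density and continuity the preceding bound extends to all `y`, `z` in `A`; at `(δx, δv)` its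
right side is `0`. -/
theorem IsCompletelyDissipative.linearized_form_nonpos (hδ : δ.IsCompletelyDissipative)
    (hdense : Dense (δ.domain : Set A)) (h1 : (1 : A) ∈ δ.domain) (hδ1 : δ ⟨1, h1⟩ = 0)
    (x v : δ.domain) (h : star (x : A) * x + ((v : A) + star (v : A)) = 0) :
    star (x : A) * δ x + star (δ x) * x + (δ v + star (δ v)) ≤ 0 := by
  have hclosed : _root_.IsClosed {p : A × A | star (x : A) * p.1 + star p.1 * x + (p.2 + star p.2) ≤
      (2 * ‖(x : A)‖ * ‖p.1 - δ x‖ + 2 * ‖p.2 - δ v‖) • (1 : A)} :=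
    isClosed_le (by fun_prop) (by fun_prop)
  have hsub : (δ.domain : Set A) ×ˢ (δ.domain : Set A) ⊆
      {p : A × A | star (x : A) * p.1 + star p.1 * x + (p.2 + star p.2) ≤
        (2 * ‖(x : A)‖ * ‖p.1 - δ x‖ + 2 * ‖p.2 - δ v‖) • (1 : A)} :=
    fun p hp => hδ.linearized_form_le h1 hδ1 x v h ⟨p.1, hp.1⟩ ⟨p.2, hp.2⟩
  have := hclosed.closure_subset_iff.2 hsub ((hdense.prod hdense) (δ x, δ v))
  simpa using this

theorem IsCompletelyDissipative.map_add_star_eq_zero (hδ : δ.IsCompletelyDissipative)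
    (hdense : Dense (δ.domain : Set A)) (h1 : (1 : A) ∈ δ.domain) (hδ1 : δ ⟨1, h1⟩ = 0)
    (v : δ.domain) (h : (v : A) + star (v : A) = 0) : δ v + star (δ v) = 0 := by
  have hle := hδ.linearized_form_nonpos hdense h1 hδ1 0 v (by simpa using h)
  have hge := hδ.linearized_form_nonpos hdense h1 hδ1 0 (-v) (by
    rw [Submodule.coe_neg, Submodule.coe_zero, star_neg, ← neg_add, h]
    simp)
  rw [δ.map_neg] at hge
  simp only [Submodule.coe_zero, star_zero, zero_mul, mul_zero, zero_add, star_neg,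
    ← neg_add, neg_nonpos] at hle hge
  exact le_antisymm hle hge

theorem IsCompletelyDissipative.map_star (hδ : δ.IsCompletelyDissipative)
    (hdense : Dense (δ.domain : Set A)) (h1 : (1 : A) ∈ δ.domain) (hδ1 : δ ⟨1, h1⟩ = 0)
    (x : A) (hx : x ∈ δ.domain) (hxs : star x ∈ δ.domain) :
    δ ⟨star x, hxs⟩ = star (δ ⟨x, hx⟩) := by
  -- Both `x - x*` and `i(x + x*)` are skew-adjoint, and together they determine `δ(x*)`.
  have hre := hδ.map_add_star_eq_zero hdense h1 hδ1 (⟨x, hx⟩ - ⟨star x, hxs⟩) (by simp)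
  have him := hδ.map_add_star_eq_zero hdense h1 hδ1 (Complex.I • (⟨x, hx⟩ + ⟨star x, hxs⟩))
    (by simp)
  rw [δ.map_sub, star_sub] at hre
  rw [δ.map_smul, δ.map_add, star_smul, star_add, RCLike.star_def, Complex.conj_I, neg_smul,
    ← sub_eq_add_neg, ← smul_sub, smul_eq_zero_iff_right Complex.I_ne_zero] at him
  generalize δ ⟨x, hx⟩ = a at *
  generalize δ ⟨star x, hxs⟩ = b at *
  have h2 : (2 : ℂ) • (b - star a) = 0 := by
    calc (2 : ℂ) • (b - star a) =
        (a + b - (star a + star b)) - (a - b + (star a - star b)) := by module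
      _ = 0 := by rw [hre, him, sub_zero]
  exact sub_eq_zero.1 ((smul_eq_zero_iff_right two_ne_zero).1 h2)

theorem IsCompletelyDissipative.star_mul_add_star_mul_le_map (hδ : δ.IsCompletelyDissipative)
    (hdense : Dense (δ.domain : Set A)) (h1 : (1 : A) ∈ δ.domain) (hδ1 : δ ⟨1, h1⟩ = 0)
    (x : A) (hx : x ∈ δ.domain) (hxx : star x * x ∈ δ.domain) :
    star (δ ⟨x, hx⟩) * x + star x * δ ⟨x, hx⟩ ≤ δ ⟨star x * x, hxx⟩ := by
  have hsa : star (δ ⟨star x * x, hxx⟩) = δ ⟨star x * x, hxx⟩ := by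
    have hs : star (star x * x) = star x * x := (IsSelfAdjoint.star_mul_self x).star_eq
    have hxx' : star (star x * x) ∈ δ.domain := hs.symm ▸ hxx
    rw [← hδ.map_star hdense h1 hδ1 _ hxx hxx']
    simp only [hs]
  -- The factor `-1/2` makes `v + v* = -x*x`, so `(x, v)` is a zero of the form.
  have h := hδ.linearized_form_nonpos hdense h1 hδ1 ⟨x, hx⟩
    ((-(1 / 2 : ℝ) : ℂ) • ⟨star x * x, hxx⟩) (by
      simp only [Submodule.coe_smul, star_smul, star_mul, star_star, star_neg, RCLike.star_def,
        Complex.conj_ofReal]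
      push_cast
      module)
  rw [δ.map_smul, star_smul, hsa, star_neg, RCLike.star_def, Complex.conj_ofReal] at h
  rw [← sub_nonpos]
  convert h using 1
  push_cast
  module

end LinearPMap

theorem theorem2 {A : Type*} [CStarAlgebra A] [PartialOrder A] [StarOrderedRing A]
    (δ : A →ₗ.[ℂ] A) (hdense : Dense (δ.domain : Set A)) (hδ : δ.IsCompletelyDissipative)
    (h1 : (1 : A) ∈ δ.domain) (hδ1 : δ ⟨1, h1⟩ = 0) :
    (∀ (x : A) (hx : x ∈ δ.domain) (hxx : star x * x ∈ δ.domain),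
      star (δ ⟨x, hx⟩) * x + star x * δ ⟨x, hx⟩ ≤ δ ⟨star x * x, hxx⟩) ∧
    (∀ (x : A) (hx : x ∈ δ.domain) (hxs : star x ∈ δ.domain),
      δ ⟨star x, hxs⟩ = star (δ ⟨x, hx⟩)) := by
  exact ⟨hδ.star_mul_add_star_mul_le_map hdense h1 hδ1, hδ.map_star hdense h1 hδ1⟩
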